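/- Let $\mathcal P=(\mathbf x,\mathbf r)$ be a group presentation, where $\mathbf r$ is a set of elements of the free group $F$ on $\mathbf x$. Let $Y\cup Y^{-1}$ be the set of formal symbols $({}^{u}r)^{\varepsilon}$ with $u\in F$, $r\in\mathbf r$, $\varepsilon=\pm1$. For $a=({}^{u}r)^{\varepsilon}$ put $\theta(a)=ur^{\varepsilon}u^{-1}\in F$, $a^{-1}=({}^{u}r)^{-\varepsilon}$, and ${}^{w}a=({}^{wu}r)^{\varepsilon}$ for $w\in F$. A $Y$-sequence is a finite, possibly empty, sequence $(a_1,\dots,a_n)$ of such symbols; it is an identity $Y$-sequence if $\theta(a_1)\cdots\theta(a_n)=1$ in $F$. Peiffer equivalence is the equivalence relation on $Y$-sequences generated by replacing an adjacent pair $(a,b)$ by $({}^{\theta(a)}b,a)$ or by $(b,{}^{\theta(b)^{-1}}a)$, and by deleting an adjacent pair $(a,a^{-1})$. The presentation $\mathcal P$ is called aspherical if every identity $Y$-sequence is Peiffer equivalent to the empty sequence. Let $\Upsilon$ be the monoid presented by the generators $Y\cup Y^{-1}$ and the relations $ab=({}^{\theta(a)}b)\,a$ for $a,b\in Y\cup Y^{-1}$,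 let $\sigma$ be the canonical homomorphism from the free monoid on $Y\cup Y^{-1}$ (the monoid of $Y$-sequences) onto $\Upsilon$, and let $\mathfrak U$ be the submonoid of $\Upsilon$ generated by all $\sigma(a)\sigma(a^{-1})$ with $a\in Y\cup Y^{-1}$. For a submonoid $U$ of a monoid $S$, the weak dominion $\mathrm{WDom}_S(U)$ is the set of all $d\in S$ such that $g(d)=h(d)$ for every group $K$ and all monoid homomorphisms $g,h:S\to K$ that coincide on $U$. Let $r_0\in\mathbf r$ and $\mathcal P_1=(\mathbf x,\mathbf r\setminus\{r_0\})$. Write $Y_1$, $\Upsilon_1$, $\sigma_1$, $\mathfrak U_1$ for the objects above formed from $\mathcal P_1$, and let $f:\Upsilon_1\to\Upsilon$ be the homomorphism induced by $\sigma_1(a)\mapsto\sigma(a)$. **Theorem.** If $\mathcal P$ is aspherical, then for every identity $Y_1$-sequence $d_1$, $$f(\sigma_1(d_1))\in \mathrm{WDom}_{\Upsilon}\bigl(f(\mathfrak U_1)\bigr).$$ -/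

import Mathlib

universe u v

namespace Whitehead

/-! ### Weak dominions -/

/-- The weak dominion of a submonoid `U` of a monoid `S`: the elements `d` of `S` on which any two
monoid homomorphisms from `S` to a group agree as soon as they agree on `U`. -/
def weakDominion {S : Type u} [Monoid S] (U : Submonoid S) : Set S :=
  {d | ∀ (G : Type v) [Group G] (f g : S →* G), (∀ s ∈ U, f s = g s) → f d = g d}

/-! ### Y-sequences of a group presentation

A group presentation is given by a type `X` of generators and a set `R` of elements of the free
group on `X` (the relators). -/

/-- The formal symbols `(ᵘr)^ε` with `u` in the free group, `r` a relator and `ε = ±1`,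
that is, the elements of `Y ∪ Y⁻¹`. -/
@[ext]
structure YLetter {X : Type u} (R : Set (FreeGroup X)) where
  /-- the conjugating element `u` -/
  conj : FreeGroup X
  /-- the relator `r` -/
  rel : R
  /-- the sign `ε` -/
  sign : ℤˣ

namespace YLetter

variable {X : Type u} {R : Set (FreeGroup X)}

/-- The value `u r^ε u⁻¹` of the symbol `(ᵘr)^ε` in the free group. -/
def theta (a : YLetter R) : FreeGroup X :=
  a.conj * (a.rel : FreeGroup X) ^ (a.sign : ℤ) * a.conj⁻¹

/-- The formal inverse `(ᵘr)^(-ε)` of `(ᵘr)^ε`. -/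
def inv (a : YLetter R) : YLetter R := ⟨a.conj, a.rel, -a.sign⟩

/-- The left action of the free group: `w` sends `(ᵘr)^ε` to `(ʷᵘr)^ε`. -/
def act (w : FreeGroup X) (a : YLetter R) : YLetter R := ⟨w * a.conj, a.rel, a.sign⟩

/-- A symbol over a set of relators is also a symbol over any larger set of relators. -/
def incl {R₁ : Set (FreeGroup X)} (h : R₁ ⊆ R) (a : YLetter R₁) : YLetter R :=
  ⟨a.conj, Set.inclusion h a.rel, a.sign⟩

end YLetter

section Presentation

variable {X : Type u} (R : Set (FreeGroup X))

/-- The `Y`-sequences: finite, possibly empty sequences of symbols `(ᵘr)^ε`, as the free monoid on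
`Y ∪ Y⁻¹`. -/
abbrev YSeq := FreeMonoid (YLetter R)

/-- A `Y`-sequence `((ᵘ¹r₁)^ε₁, …, (ᵘⁿrₙ)^εₙ)` is an identity `Y`-sequence if the product of the
`uᵢ rᵢ^εᵢ uᵢ⁻¹` is trivial in the free group. -/
def IsIdentityYSeq (d : YSeq R) : Prop := FreeMonoid.lift YLetter.theta d = 1

/-- The elementary Peiffer operations on `Y`-sequences: the two exchanges and the deletion. -/
inductive PeifferStep : YSeq R → YSeq R → Prop
  | exchange_left (p q : YSeq R) (a b : YLetter R) :
      PeifferStep (p * (FreeMonoid.of a * FreeMonoid.of b) * q)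
        (p * (FreeMonoid.of (b.act a.theta) * FreeMonoid.of a) * q)
  | exchange_right (p q : YSeq R) (a b : YLetter R) :
      PeifferStep (p * (FreeMonoid.of a * FreeMonoid.of b) * q)
        (p * (FreeMonoid.of b * FreeMonoid.of (a.act b.theta⁻¹)) * q)
  | deletion (p q : YSeq R) (a : YLetter R) :
      PeifferStep (p * (FreeMonoid.of a * FreeMonoid.of a.inv) * q) (p * q)

/-- Peiffer equivalence: the equivalence relation generated by exchanges, deletions and (through
symmetry) insertions. -/
def PeifferEquiv : YSeq R → YSeq R → Prop := Relation.EqvGen (PeifferStep R)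

/-- A presentation is aspherical if every identity `Y`-sequence is Peiffer equivalent to the empty
sequence. -/
def IsAspherical : Prop := ∀ d : YSeq R, IsIdentityYSeq R d → PeifferEquiv R d 1

/-! ### The monoid of `Y`-sequences up to exchange -/

/-- The defining relations `ab = (^{θ(a)}b) a`, for `a, b ∈ Y ∪ Y⁻¹`. -/
inductive UpsilonRel : FreeMonoid (YLetter R) → FreeMonoid (YLetter R) → Prop
  | mk (a b : YLetter R) :
      UpsilonRel (FreeMonoid.of a * FreeMonoid.of b)
        (FreeMonoid.of (b.act a.theta) * FreeMonoid.of a)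

/-- The monoid `Υ` with generators `Y ∪ Y⁻¹` and relations `ab = (^{θ(a)}b) a`. -/
abbrev Upsilon := PresentedMonoid (UpsilonRel R)

/-- The canonical homomorphism `σ` from the free monoid on `Y ∪ Y⁻¹` to `Υ`. -/
abbrev sigma : YSeq R →* Upsilon R := PresentedMonoid.mk (UpsilonRel R)

/-- The submonoid `𝔘` of `Υ` generated by the elements `σ(a)σ(a⁻¹)`, `a ∈ Y ∪ Y⁻¹`. -/
def frakU : Submonoid (Upsilon R) :=
  Submonoid.closure
    (Set.range fun a : YLetter R => sigma R (FreeMonoid.of a) * sigma R (FreeMonoid.of a.inv))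

end Presentation

/-- For `R₁ ⊆ R`, the homomorphism `f : Υ₁ → Υ` induced by `σ₁(a) ↦ σ(a)`. -/
def upsilonMap {X : Type u} {R₁ R : Set (FreeGroup X)} (h : R₁ ⊆ R) : Upsilon R₁ →* Upsilon R :=
  PresentedMonoid.lift (fun a => sigma R (FreeMonoid.of (a.incl h))) (by
    rintro _ _ ⟨a, b⟩
    simp only [map_mul, FreeMonoid.lift_eval_of]
    rw [← map_mul, ← map_mul]
    exact PresentedMonoid.mk_eq_mk_of_rel (UpsilonRel.mk (a.incl h) (b.incl h)))

end Whitehead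

/-! The elements `σ(a)σ(a⁻¹)` are central in `Υ`. Hence, given a homomorphism `φ` from `Υ` to a
group, replacing the value `φ(σ(a))` of every positive symbol `a` of a `Y`-sequence by
`φ(σ(a⁻¹))⁻¹` divides `φ(σ(d))` by the product of the `φ(σ(a)σ(a⁻¹))` over the positive symbols of
`d`. The new value is invariant under deletions as well as exchanges, so if `𝒫` is aspherical it is
trivial on identity `Y`-sequences. Thus `φ(σ(d))` is the `φ`-image of an element of `𝔘` which
depends only on `d`, not on `φ`, and which lies in `f(𝔘₁)` if `d` comes from a `Y₁`-sequence. -/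

namespace Whitehead

open FreeMonoid (of)

variable {X : Type u} {R : Set (FreeGroup X)}

namespace YLetter

@[simp]
theorem inv_inv (a : YLetter R) : a.inv.inv = a := by
  ext <;> simp [inv]

@[simp]
theorem theta_inv (a : YLetter R) : a.inv.theta = a.theta⁻¹ := by
  simp [inv, theta, mul_assoc]

@[simp]
theorem act_act (v w : FreeGroup X) (a : YLetter R) : (a.act w).act v = a.act (v * w) := by
  simp [act, mul_assoc]

@[simp]
theorem act_one (a : YLetter R) : a.act 1 = a := by
  simp [act]

theorem inv_act (w : FreeGroup X) (a : YLetter R) : (a.act w).inv = a.inv.act w := rfl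

theorem sign_inv_eq_one_iff (a : YLetter R) : a.inv.sign = 1 ↔ a.sign ≠ 1 := by
  rw [inv, neg_eq_iff_eq_neg, Int.units_ne_iff_eq_neg]

end YLetter

theorem PeifferEquiv.map_eq {M : Type*} [Monoid M] {ψ : YSeq R →* M}
    (exchange : ∀ a b, ψ (of a) * ψ (of b) = ψ (of (b.act a.theta)) * ψ (of a))
    (deletion : ∀ a, ψ (of a) * ψ (of a.inv) = 1) {d d' : YSeq R} (h : PeifferEquiv R d d') :
    ψ d = ψ d' := by
  induction h with
  | rel _ _ h =>
    cases h with
    | exchange_left p q a b => simp only [map_mul, exchange a b]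
    | exchange_right p q a b => simp [exchange b (a.act b.theta⁻¹)]
    | deletion p q a => simp only [map_mul, deletion, mul_one]
  | refl _ => rfl
  | symm _ _ _ ih => exact ih.symm
  | trans _ _ _ _ _ ih₁ ih₂ => exact ih₁.trans ih₂

theorem sigma_of_mul_sigma_of (a b : YLetter R) :
    sigma R (of a) * sigma R (of b) = sigma R (of (b.act a.theta)) * sigma R (of a) :=
  PresentedMonoid.mk_eq_mk_of_rel (UpsilonRel.mk a b)

theorem commute_sigma_of_mul_sigma_of_inv (a b : YLetter R) :
    Commute (sigma R (of a) * sigma R (of a.inv)) (sigma R (of b)) := by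
  rw [Commute, SemiconjBy, mul_assoc, sigma_of_mul_sigma_of a.inv, ← mul_assoc,
    sigma_of_mul_sigma_of a, YLetter.act_act, YLetter.theta_inv, mul_inv_cancel, YLetter.act_one,
    mul_assoc]

theorem frakU_le_center : frakU R ≤ Submonoid.center (Upsilon R) := by
  refine Submonoid.closure_le.2 (Set.range_subset_iff.2 fun a =>
    Submonoid.mem_center_iff.2 fun s => ?_)
  obtain ⟨d, rfl⟩ := PresentedMonoid.surjective_mk s
  induction d using FreeMonoid.inductionOn' with
  | one => simp
  | of_mul b d ih =>
    rw [map_mul]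
    exact ((commute_sigma_of_mul_sigma_of_inv a b).mul_right ih.symm).eq.symm

/-- The product in `Υ` of the elements `σ(a)σ(a⁻¹)` over the positive symbols `a = ᵘr` of a
`Y`-sequence. -/
def positivePairs : YSeq R →* Upsilon R :=
  FreeMonoid.lift fun a => if a.sign = 1 then sigma R (of a) * sigma R (of a.inv) else 1

theorem positivePairs_mem_frakU (d : YSeq R) : positivePairs d ∈ frakU R := by
  suffices MonoidHom.mrange (positivePairs (R := R)) ≤ frakU R from this ⟨d, rfl⟩
  rw [positivePairs, FreeMonoid.mrange_lift, Submonoid.closure_le, Set.range_subset_iff]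
  intro a
  split_ifs
  · exact Submonoid.subset_closure ⟨a, rfl⟩
  · exact one_mem _

theorem mul_positivePairs_comm (s : Upsilon R) (d : YSeq R) :
    s * positivePairs d = positivePairs d * s :=
  Submonoid.mem_center_iff.1 (frakU_le_center (positivePairs_mem_frakU d)) s

section Subpresentation

variable {R₁ : Set (FreeGroup X)} (h : R₁ ⊆ R)

theorem IsIdentityYSeq.map_incl {d : YSeq R₁} (hd : IsIdentityYSeq R₁ d) :
    IsIdentityYSeq R (FreeMonoid.map (YLetter.incl h) d) := by
  suffices (FreeMonoid.lift YLetter.theta).comp (FreeMonoid.map (YLetter.incl h)) =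
      FreeMonoid.lift (YLetter.theta (R := R₁)) from (DFunLike.congr_fun this d).trans hd
  ext a
  rfl

theorem upsilonMap_sigma (d : YSeq R₁) :
    upsilonMap h (sigma R₁ d) = sigma R (FreeMonoid.map (YLetter.incl h) d) := by
  suffices (upsilonMap h).comp (sigma R₁) = (sigma R).comp (FreeMonoid.map (YLetter.incl h)) from
    DFunLike.congr_fun this d
  ext a
  rfl

theorem upsilonMap_positivePairs (d : YSeq R₁) :
    upsilonMap h (positivePairs d) = positivePairs (FreeMonoid.map (YLetter.incl h) d) := by
  suffices (upsilonMap h).comp positivePairs =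
      positivePairs.comp (FreeMonoid.map (YLetter.incl h)) from DFunLike.congr_fun this d
  ext a
  by_cases ha : a.sign = 1 <;> simp [positivePairs, YLetter.incl, ha, YLetter.inv, upsilonMap_sigma]

end Subpresentation

section GroupEval

variable {K : Type*} [Group K] (φ : Upsilon R →* K)

theorem map_sigma_of_act_theta (a b : YLetter R) :
    φ (sigma R (of (b.act a.theta))) =
      φ (sigma R (of a)) * φ (sigma R (of b)) * (φ (sigma R (of a)))⁻¹ := by
  rw [← map_mul, sigma_of_mul_sigma_of, map_mul, mul_inv_cancel_right]

/-- The value of a `Y`-sequence in a group when each negative symbol `a` is evaluated as `φ(σ(a))`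
and each positive one as `φ(σ(a⁻¹))⁻¹`, so that formally inverse symbols have inverse values. -/
def groupEval : YSeq R →* K :=
  FreeMonoid.lift fun a =>
    if a.sign = 1 then (φ (sigma R (of a.inv)))⁻¹ else φ (sigma R (of a))

variable {a : YLetter R}

theorem groupEval_of_sign_eq_one (ha : a.sign = 1) :
    groupEval φ (of a) = (φ (sigma R (of a.inv)))⁻¹ := by
  simp [groupEval, ha]

theorem groupEval_of_sign_ne_one (ha : a.sign ≠ 1) :
    groupEval φ (of a) = φ (sigma R (of a)) := by
  simp [groupEval, ha]

variable (a)

theorem groupEval_of_inv : groupEval φ (of a.inv) = (groupEval φ (of a))⁻¹ := by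
  by_cases ha : a.sign = 1 <;> simp [groupEval, YLetter.sign_inv_eq_one_iff, ha]

theorem map_sigma_of_act_theta_eq_groupEval_conj (b : YLetter R) :
    φ (sigma R (of (b.act a.theta))) =
      groupEval φ (of a) * φ (sigma R (of b)) * (groupEval φ (of a))⁻¹ := by
  by_cases ha : a.sign = 1
  · have conj_by_inv := map_sigma_of_act_theta φ a.inv (b.act a.theta)
    rw [YLetter.act_act, YLetter.theta_inv, inv_mul_cancel, YLetter.act_one] at conj_by_inv
    rw [groupEval_of_sign_eq_one φ ha, conj_by_inv]
    group
  · rw [groupEval_of_sign_ne_one φ ha, map_sigma_of_act_theta]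

theorem groupEval_of_act_theta (b : YLetter R) :
    groupEval φ (of (b.act a.theta)) =
      groupEval φ (of a) * groupEval φ (of b) * (groupEval φ (of a))⁻¹ := by
  by_cases hb : b.sign = 1
  · rw [groupEval_of_sign_eq_one φ hb, groupEval_of_sign_eq_one φ (a := b.act a.theta) hb,
      YLetter.inv_act, map_sigma_of_act_theta_eq_groupEval_conj, conj_inv]
  · rw [groupEval_of_sign_ne_one φ hb, groupEval_of_sign_ne_one φ (a := b.act a.theta) hb,
      map_sigma_of_act_theta_eq_groupEval_conj]

theorem map_sigma_of_eq_groupEval_mul :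
    φ (sigma R (of a)) = groupEval φ (of a) * φ (positivePairs (of a)) := by
  by_cases ha : a.sign = 1
  · have comm : φ (sigma R (of a)) * φ (sigma R (of a.inv)) =
        φ (sigma R (of a.inv)) * φ (sigma R (of a)) := by
      apply mul_right_cancel (b := φ (sigma R (of a.inv)))
      simpa only [map_mul, mul_assoc] using
        congrArg φ (commute_sigma_of_mul_sigma_of_inv a a.inv).eq
    simp [groupEval_of_sign_eq_one, positivePairs, ha, comm]
  · simp [groupEval_of_sign_ne_one, positivePairs, ha]

theorem map_sigma_eq_groupEval_mul (d : YSeq R) :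
    φ (sigma R d) = groupEval φ d * φ (positivePairs d) := by
  induction d using FreeMonoid.inductionOn' with
  | one => simp
  | of_mul a d ih =>
    calc φ (sigma R (of a * d))
        = groupEval φ (of a) * φ (positivePairs (of a) * sigma R d) := by
          simp only [map_mul, map_sigma_of_eq_groupEval_mul φ a, mul_assoc]
      _ = groupEval φ (of a) * (groupEval φ d * φ (positivePairs d * positivePairs (of a))) := by
          rw [← mul_positivePairs_comm, map_mul, ih, map_mul, mul_assoc]
      _ = groupEval φ (of a * d) * φ (positivePairs (of a * d)) := by
          rw [mul_positivePairs_comm, ← map_mul positivePairs, ← mul_assoc, ← map_mul]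

end GroupEval

theorem IsAspherical.groupEval_eq_one {K : Type*} [Group K] (hR : IsAspherical R)
    (φ : Upsilon R →* K) {d : YSeq R} (hd : IsIdentityYSeq R d) : groupEval φ d = 1 := by
  rw [(hR d hd).map_eq (ψ := groupEval φ), map_one]
  · simp [groupEval_of_act_theta]
  · simp [groupEval_of_inv]

theorem IsAspherical.map_sigma_eq_map_positivePairs {K : Type*} [Group K] (hR : IsAspherical R)
    (φ : Upsilon R →* K) {d : YSeq R} (hd : IsIdentityYSeq R d) :
    φ (sigma R d) = φ (positivePairs d) := by
  rw [map_sigma_eq_groupEval_mul, hR.groupEval_eq_one φ hd, one_mul]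

end Whitehead

open Whitehead in
theorem mainTheorem5_general {X : Type u} {R₁ R : Set (FreeGroup X)} (h : R₁ ⊆ R)
    (hR : IsAspherical R) {d₁ : YSeq R₁} (hd₁ : IsIdentityYSeq R₁ d₁) :
    upsilonMap h (sigma R₁ d₁) ∈ weakDominion.{u, v} ((frakU R₁).map (upsilonMap h)) := by
  intro K _ g k hgk
  have map_eq (φ : Upsilon R →* K) :
      φ (upsilonMap h (sigma R₁ d₁)) = φ (upsilonMap h (positivePairs d₁)) := by
    rw [upsilonMap_sigma, upsilonMap_positivePairs]
    exact hR.map_sigma_eq_map_positivePairs φ (hd₁.map_incl h)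
  rw [map_eq g, map_eq k]
  exact hgk _ (Submonoid.mem_map_of_mem _ (positivePairs_mem_frakU d₁))

theorem mainTheorem5 {X : Type u} (R : Set (FreeGroup X)) (r₀ : FreeGroup X) (hr₀ : r₀ ∈ R)
    (hR : Whitehead.IsAspherical R)
    (d₁ : Whitehead.YSeq (R \ {r₀})) (hd₁ : Whitehead.IsIdentityYSeq (R \ {r₀}) d₁) :
    Whitehead.upsilonMap (R₁ := R \ {r₀}) (R := R) Set.sdiff_subset
        (Whitehead.sigma (R \ {r₀}) d₁) ∈
      Whitehead.weakDominion.{u, v}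
        ((Whitehead.frakU (R \ {r₀})).map
          (Whitehead.upsilonMap (R₁ := R \ {r₀}) (R := R) Set.sdiff_subset)) :=
  mainTheorem5_general Set.sdiff_subset hR hd₁
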